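/- Let $S$ be a countable set, let $P=(P_{a,b})_{a,b\in S}$ be a stochastic matrix, and let $\lambda=(\lambda_s)_{s\in S}$ be a strictly positive vector with $\lambda P=\lambda$ and $\sum_{s\in S}\lambda_s=\infty$ (so $S$ is infinite). Let $X=S^{\mathbb Z}$ with its product $\sigma$-algebra ($S$ being discrete), let $T$ be the left shift on $X$, $(Tx)_n=x_{n+1}$, and let $\mu=\mu_{P,\lambda}$ be the $\sigma$-finite $T$-invariant measure on $X$ determined by $$\mu(\{x : x_l=s_0,\dots,x_{l+r}=s_r\})=\lambda_{s_0}P_{s_0,s_1}\cdots P_{s_{r-1},s_r}\qquad(l\in\mathbb Z,\ r\ge 0,\ s_0,\dots,s_r\in S).$$ The system $(X,\mu,T)$ is called an infinite Markov shift. Let $0\le m\le k$ be integers. Then the transformation $$\underbrace{T\times\cdots\times T}_{m\text{ times}}\times\underbrace{T^{-1}\times\cdots\times T^{-1}}_{k-m\text{ times}}$$ of $(X^k,\mu^{\otimes k})$ is conservative and ergodic if and only if the transformation $\underbrace{T\times\cdots\times T}_{k\text{ times}}$ of $(X^k,\mu^{\otimes k})$ is conservative and ergodic. -/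

import Mathlib

open MeasureTheory ProbabilityTheory
open scoped NNReal ENNReal

/-! ### One-sided Markov chains -/

section Chain

theorem measurableSet_eval_eq {ι S : Type*} [MeasurableSpace S] [DiscreteMeasurableSpace S]
    (i : ι) (a : S) : MeasurableSet {x : ι → S | x i = a} := by
  change MeasurableSet ((fun x : ι → S => x i) ⁻¹' {a})
  exact measurable_pi_apply i (measurableSet_singleton a)

variable {S : Type*} [MeasurableSpace S] [DiscreteMeasurableSpace S]

/-- Given transition probabilities `p`, the kernel sending a path `x₀, …, xₙ` to the law `p xₙ` of
the next state. -/
noncomputable def stepKernel (p : S → PMF S) (n : ℕ) :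
    Kernel ((_ : Finset.Iic n) → S) S where
  toFun x := (p (x ⟨n, Finset.mem_Iic.2 le_rfl⟩)).toMeasure
  measurable' :=
    (Measurable.of_discrete (f := fun s => (p s).toMeasure)).comp (measurable_pi_apply _)

instance stepKernel_isMarkovKernel (p : S → PMF S) (n : ℕ) : IsMarkovKernel (stepKernel p n) :=
  ⟨fun x => PMF.toMeasure.isProbabilityMeasure (p (x ⟨n, Finset.mem_Iic.2 le_rfl⟩))⟩

/-- The law on `S^ℕ` of the Markov chain started at `s` with transition probabilities `p`. -/
noncomputable def chainLaw (p : S → PMF S) (s : S) : Measure (ℕ → S) :=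
  Kernel.traj (X := fun _ => S) (stepKernel p) 0 (fun _ => s)

instance chainLaw_isProbabilityMeasure (p : S → PMF S) (s : S) :
    IsProbabilityMeasure (chainLaw p s) := by
  unfold chainLaw; infer_instance

open Classical in
theorem chainLaw_cylinder (p : S → PMF S) (s : S) (w : ℕ → S) (n : ℕ) :
    chainLaw p s {x | ∀ i ≤ n, x i = w i} =
      if w 0 = s then ∏ i ∈ Finset.range n, p (w i) (w (i + 1)) else 0 := by
  induction n with
  | zero =>
    have hm : MeasurableSet {y : (_ : Finset.Iic 0) → S | y ⟨0, by simp⟩ = w 0} :=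
      measurableSet_eval_eq _ _
    have h := Kernel.traj_map_frestrictLe_apply (X := fun _ => S) (κ := stepKernel p) 0 0
      (fun _ => s)
    have h2 := congrArg (fun m => m {y : (_ : Finset.Iic 0) → S | y ⟨0, by simp⟩ = w 0}) h
    rw [Measure.map_apply (by fun_prop) hm, Kernel.partialTraj_self, Kernel.id_apply,
      Measure.dirac_apply' _ hm] at h2
    have hs : {x : ℕ → S | ∀ i ≤ 0, x i = w i} = (Preorder.frestrictLe (π := fun _ => S) 0) ⁻¹'
        {y : (_ : Finset.Iic 0) → S | y ⟨0, by simp⟩ = w 0} := by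
      ext x; simp [Preorder.frestrictLe]
    rw [hs]
    refine h2.trans ?_
    simp [Set.indicator_apply, eq_comm]
  | succ n ih =>
    set A : Set ((_ : Finset.Iic n) → S) := {y | ∀ i : Finset.Iic n, y i = w i} with hA
    have hAm : MeasurableSet A := by
      have : A = ⋂ i : Finset.Iic n, {y | y i = w i} := by ext; simp [hA]
      rw [this]
      exact MeasurableSet.iInter fun i => measurableSet_eval_eq i _
    have hpre : {x : ℕ → S | ∀ i ≤ n, x i = w i} =
        (Preorder.frestrictLe (π := fun _ => S) n) ⁻¹' A := by
      ext x; simp [hA, Preorder.frestrictLe]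
    have hset : {x : ℕ → S | ∀ i ≤ n + 1, x i = w i} =
        (fun x : ℕ → S => (Preorder.frestrictLe (π := fun _ => S) n x, x (n + 1))) ⁻¹'
          (A ×ˢ {w (n + 1)}) := by
      ext x
      simp only [Set.mem_ofPred_eq, Set.mem_preimage, Set.mem_prod, Set.mem_singleton_iff, hA,
        Preorder.frestrictLe, Finset.restrict, Subtype.forall, Finset.mem_Iic]
      constructor
      · intro h
        exact ⟨fun i hi => h i (by omega), h _ le_rfl⟩
      · rintro ⟨h1, h2⟩ i hi
        rcases Nat.lt_or_ge n i with h | h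
        · obtain rfl : i = n + 1 := by omega
          exact h2
        · exact h1 i h
    have hA' : Kernel.partialTraj (X := fun _ => S) (stepKernel p) 0 n (fun _ => s) A =
        chainLaw p s {x | ∀ i ≤ n, x i = w i} := by
      rw [hpre, ← Kernel.traj_map_frestrictLe_apply, Measure.map_apply (by fun_prop) hAm]
      rfl
    have key : chainLaw p s {x : ℕ → S | ∀ i ≤ n + 1, x i = w i} =
        ((Kernel.partialTraj (X := fun _ => S) (stepKernel p) 0 n (fun _ => s)) ⊗ₘ
          (stepKernel p n)) (A ×ˢ {w (n + 1)}) := by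
      rw [hset]
      rw [Kernel.partialTraj_compProd_eq_map_traj (X := fun _ => S) (κ := stepKernel p)
        (Nat.zero_le n), Measure.map_apply (by fun_prop) (hAm.prod (measurableSet_singleton _))]
      rfl
    rw [key, Measure.compProd_apply_prod hAm (measurableSet_singleton _)]
    have hc : ∀ y ∈ A, stepKernel p n y {w (n + 1)} = p (w n) (w (n + 1)) := by
      intro y hy
      have : y ⟨n, Finset.mem_Iic.2 le_rfl⟩ = w n := hy _
      change (p (y ⟨n, Finset.mem_Iic.2 le_rfl⟩)).toMeasure {w (n + 1)} = _
      rw [this, PMF.toMeasure_apply_singleton _ _ (measurableSet_singleton _)]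
    rw [setLIntegral_congr_fun hAm hc, setLIntegral_const, hA', ih, Finset.prod_range_succ]
    split_ifs <;> simp [mul_comm]

end Chain

/-! ### Infinite Markov shifts -/

/-- A stochastic matrix `P` over the state space `S` together with a strictly positive left
eigenvector `lam` of `P` with eigenvalue `1` and infinite total mass.  (The last condition forces
`S` to be infinite.) -/
structure InfiniteMarkovData (S : Type*) where
  /-- The transition matrix. -/
  P : S → S → ℝ≥0
  /-- The stationary vector. -/
  lam : S → ℝ≥0
  stochastic : ∀ a, HasSum (fun b => P a b) 1
  lam_pos : ∀ a, 0 < lam a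
  lam_mul_P : ∀ b, HasSum (fun a => lam a * P a b) (lam b)
  infinite_mass : ¬ Summable lam

namespace InfiniteMarkovData

variable {S : Type*} (M : InfiniteMarkovData S)

/-- The transition probabilities `b ↦ P a b`. -/
noncomputable def forward (a : S) : PMF S :=
  ⟨fun b => (M.P a b : ℝ≥0∞), ENNReal.hasSum_coe.2 (M.stochastic a)⟩

/-- The transition probabilities `a ↦ lam a * P a b / lam b` of the time-reversed chain. -/
noncomputable def backward (b : S) : PMF S :=
  ⟨fun a => ((M.lam a * M.P a b / M.lam b : ℝ≥0) : ℝ≥0∞), by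
    have h := (M.lam_mul_P b).div_const (M.lam b)
    rw [div_self (M.lam_pos b).ne'] at h
    exact ENNReal.hasSum_coe.2 h⟩

/-- Glue a future `x` and a past `y` to a two-sided sequence, `x₀` being placed at time `0`. -/
def glue (z : (ℕ → S) × (ℕ → S)) (n : ℤ) : S :=
  if 0 ≤ n then z.1 n.toNat else z.2 (-n).toNat

variable [MeasurableSpace S]

theorem measurable_glue : Measurable (glue (S := S)) := by
  refine measurable_pi_lambda _ fun n => ?_
  unfold glue
  split_ifs <;> fun_prop

/-- The left shift `T` on `S^ℤ`, `(T x)ₙ = xₙ₊₁`, as an invertible measurable map. -/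
def shift : (ℤ → S) ≃ᵐ (ℤ → S) where
  toFun x n := x (n + 1)
  invFun x n := x (n - 1)
  left_inv x := by funext n; simp
  right_inv x := by funext n; simp
  measurable_toFun := measurable_pi_lambda _ fun n => measurable_pi_apply (n + 1)
  measurable_invFun := measurable_pi_lambda _ fun n => measurable_pi_apply (n - 1)

/-- The transformation `T × ⋯ × T × T⁻¹ × ⋯ × T⁻¹` of `(S^ℤ)^k`, acting by the shift `T` on the
first `m` coordinates and by its inverse on the `k - m` other ones. -/
def mixedShift (k m : ℕ) (x : Fin k → ℤ → S) (i : Fin k) : ℤ → S :=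
  if (i : ℕ) < m then shift (x i) else shift.symm (x i)

/-- The transformation `T × ⋯ × T` (`k` times) of `(S^ℤ)^k`, `T` being the shift. -/
def powerShift (k : ℕ) (x : Fin k → ℤ → S) (i : Fin k) : ℤ → S :=
  shift (x i)

variable [DiscreteMeasurableSpace S]

/-- The Markov measure `μ_{P,lam}` on `S^ℤ`: the state at time `0` is distributed according to
`lam`, and given this state, the future and the past are independent, the future being the Markov
chain with transition matrix `P`, and the past the Markov chain with the reversed transition matrix
`lam a * P a b / lam b`.  It gives each cylinder `[s₀, …, s_k]`, placed at any times `l, …, l + k`,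
the mass `lam s₀ * P s₀ s₁ * ⋯ * P s_{k-1} s_k`, see `markovMeasure_cylinder`. -/
noncomputable def markovMeasure : Measure (ℤ → S) :=
  Measure.sum fun s => (M.lam s : ℝ≥0∞) •
    ((chainLaw M.forward s).prod (chainLaw M.backward s)).map glue

theorem measurableSet_window (a : ℤ) (n : ℕ) (v : ℤ → S) :
    MeasurableSet {x : ℤ → S | ∀ i : ℕ, i ≤ n → x (a + i) = v (a + i)} := by
  have : {x : ℤ → S | ∀ i : ℕ, i ≤ n → x (a + i) = v (a + i)} =
      ⋂ i : ℕ, ⋂ _ : i ≤ n, {x | x (a + i) = v (a + i)} := by ext; simp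
  rw [this]
  exact MeasurableSet.iInter fun i => MeasurableSet.iInter fun _ =>
    measurableSet_eval_eq _ _

theorem window_zero (v : ℤ → S) (p q : ℕ) :
    M.markovMeasure {x | ∀ i : ℕ, i ≤ p + q → x (-p + i) = v (-p + i)} =
      M.lam (v (-p)) * ∏ i ∈ Finset.range (p + q), (M.P (v (-p + i)) (v (-p + i + 1)) : ℝ≥0∞) := by
  classical
  have hm := measurableSet_window (-p : ℤ) (p + q) v
  have hg : glue ⁻¹' {x : ℤ → S | ∀ i : ℕ, i ≤ p + q → x (-p + i) = v (-p + i)} ∩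
        {z | z.1 0 = z.2 0} =
      ({x : ℕ → S | ∀ i ≤ q, x i = v i} ×ˢ {y : ℕ → S | ∀ i ≤ p, y i = v (-i)}) := by
    ext ⟨x, y⟩
    simp only [Set.mem_inter_iff, Set.mem_preimage, Set.mem_ofPred_eq, Set.mem_prod, glue]
    constructor
    · rintro ⟨h, h0⟩
      have hx : ∀ i ≤ q, x i = v i := by
        intro i hi
        have := h (p + i) (by omega)
        simpa using this
      refine ⟨hx, fun i hi => ?_⟩
      rcases Nat.eq_zero_or_pos i with rfl | hi0
      · rw [← h0]; simpa using hx 0 (Nat.zero_le _)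
      · have := h (p - i) (by omega)
        have e : (-(p : ℤ) + ((p - i : ℕ) : ℤ)) = -i := by omega
        rw [e, if_neg (by omega)] at this
        simpa using this
    · rintro ⟨hx, hy⟩
      refine ⟨fun i hi => ?_, ?_⟩
      · split_ifs with h
        · rw [hx _ (by omega)]; congr 1; omega
        · rw [hy _ (by omega)]; congr 1; omega
      · rw [hx 0 (Nat.zero_le _), hy 0 (Nat.zero_le _)]; simp
  have hstart : ∀ (t : S → PMF S) (s : S), ∀ᵐ x ∂(chainLaw t s), x 0 = s := by
    intro t s
    have := chainLaw_cylinder t s (fun _ => s) 0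
    simp only [Nat.le_zero, forall_eq, if_true, Finset.range_zero, Finset.prod_empty] at this
    exact (prob_compl_eq_zero_iff (measurableSet_eval_eq 0 s)).2 this
  have hterm : ∀ s, ((chainLaw M.forward s).prod (chainLaw M.backward s)).map glue
      {x | ∀ i : ℕ, i ≤ p + q → x (-p + i) = v (-p + i)} =
      if v 0 = s then (∏ i ∈ Finset.range q, (M.P (v i) (v (i + 1)) : ℝ≥0∞)) *
        ∏ i ∈ Finset.range p, M.backward (v (-i)) (v (-i - 1)) else 0 := by
    intro s
    rw [Measure.map_apply measurable_glue hm]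
    have hae : ∀ᵐ z ∂((chainLaw M.forward s).prod (chainLaw M.backward s)), z.1 0 = z.2 0 := by
      have h1 := Measure.quasiMeasurePreserving_fst (μ := chainLaw M.forward s) (ν := chainLaw M.backward s)
        |>.ae (hstart M.forward s)
      have h2 := Measure.quasiMeasurePreserving_snd (μ := chainLaw M.forward s) (ν := chainLaw M.backward s)
        |>.ae (hstart M.backward s)
      filter_upwards [h1, h2] with z h1 h2
      rw [h1, h2]
    have hae' := Measure.measure_inter_eq_of_ae (t := {z : (ℕ → S) × (ℕ → S) | z.1 0 = z.2 0})
      (s := glue ⁻¹' {x : ℤ → S | ∀ i : ℕ, i ≤ p + q → x (-p + i) = v (-p + i)}) hae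
    rw [← hae', Set.inter_comm, hg,
      Measure.prod_prod, chainLaw_cylinder _ _ (fun i => v i) q,
      chainLaw_cylinder _ _ (fun i => v (-i)) p]
    simp only [Nat.cast_zero, neg_zero]
    split_ifs
    · congr 1
      refine Finset.prod_congr rfl fun i _ => ?_
      congr 2; push_cast; ring
    · simp
  have hback : ∀ p : ℕ, (M.lam (v 0) : ℝ≥0∞) *
      ∏ i ∈ Finset.range p, M.backward (v (-i)) (v (-i - 1)) =
      M.lam (v (-p)) * ∏ i ∈ Finset.range p, (M.P (v (-p + i)) (v (-p + i + 1)) : ℝ≥0∞) := by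
    intro p
    induction p with
    | zero => simp
    | succ p ih =>
      rw [Finset.prod_range_succ, ← mul_assoc, ih, Finset.prod_range_succ']
      have hb : (M.lam (v (-p)) : ℝ≥0∞) * M.backward (v (-p)) (v (-p - 1)) =
          M.lam (v (-p - 1)) * M.P (v (-p - 1)) (v (-p)) := by
        change (M.lam (v (-p)) : ℝ≥0∞) *
          ((M.lam (v (-p - 1)) * M.P (v (-p - 1)) (v (-p)) / M.lam (v (-p)) : ℝ≥0) : ℝ≥0∞) = _
        rw [← ENNReal.coe_mul, mul_div_cancel₀ _ (M.lam_pos _).ne', ENNReal.coe_mul]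
      have e1 : (-((p + 1 : ℕ) : ℤ)) = -p - 1 := by push_cast; ring
      have e2 : ∀ i : ℕ, (-(p : ℤ) - 1 + ((i + 1 : ℕ) : ℤ)) = -p + i := by
        intro i; push_cast; ring
      simp only [e1, e2]
      have e3 : (-(p : ℤ) - 1 + ((0 : ℕ) : ℤ)) = -p - 1 := by simp
      rw [e3, sub_add_cancel, mul_right_comm, hb]
      ring
  rw [markovMeasure, Measure.sum_apply _ hm]
  simp only [Measure.smul_apply, hterm, smul_eq_mul]
  rw [tsum_eq_single (v 0) (by intro s hs; rw [if_neg hs.symm, mul_zero]), if_pos rfl, mul_left_comm,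
    hback, Finset.prod_range_add]
  rw [mul_left_comm, mul_comm (∏ i ∈ Finset.range q, _)]
  congr 2
  refine Finset.prod_congr rfl fun i _ => ?_
  congr 3 <;> push_cast <;> ring

variable [Countable S]

theorem window_tsum (a j : ℤ) (n : ℕ) (v : ℤ → S) (T : Set (ℤ → S))
    (hT : T = {x : ℤ → S | ∀ i : ℕ, i ≤ n → a + i ≠ j → x (a + i) = v (a + i)})
    (hj : ∃ i : ℕ, i ≤ n ∧ a + i = j) :
    M.markovMeasure T = ∑' s, M.markovMeasure {x : ℤ → S | ∀ i : ℕ, i ≤ n →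
      x (a + i) = Function.update v j s (a + i)} := by
  obtain ⟨i₀, hi₀, hj⟩ := hj
  rw [← measure_iUnion]
  · congr 1
    ext x
    simp only [hT, Set.mem_ofPred_eq, Set.mem_iUnion]
    constructor
    · intro h
      refine ⟨x j, fun i hi => ?_⟩
      by_cases e : a + i = j
      · simp [e]
      · rw [Function.update_of_ne e]; exact h i hi e
    · rintro ⟨s, hs⟩ i hi e
      have := hs i hi
      rwa [Function.update_of_ne e] at this
  · intro s t hst
    refine Set.disjoint_left.2 fun x hx hy => hst ?_
    have h1 := hx i₀ hi₀
    have h2 := hy i₀ hi₀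
    rw [hj, Function.update_self] at h1 h2
    exact h1.symm.trans h2
  · exact fun s => measurableSet_window a n _

theorem window (v : ℤ → S) (a : ℤ) (n : ℕ) :
    M.markovMeasure {x | ∀ i : ℕ, i ≤ n → x (a + i) = v (a + i)} =
      M.lam (v a) * ∏ i ∈ Finset.range n, (M.P (v (a + i)) (v (a + i + 1)) : ℝ≥0∞) := by
  have dropR : ∀ (a : ℤ) (n : ℕ), (∀ v : ℤ → S,
      M.markovMeasure {x | ∀ i : ℕ, i ≤ n + 1 → x (a + i) = v (a + i)} =
      M.lam (v a) * ∏ i ∈ Finset.range (n + 1), (M.P (v (a + i)) (v (a + i + 1)) : ℝ≥0∞)) →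
      ∀ v : ℤ → S, M.markovMeasure {x | ∀ i : ℕ, i ≤ n → x (a + i) = v (a + i)} =
      M.lam (v a) * ∏ i ∈ Finset.range n, (M.P (v (a + i)) (v (a + i + 1)) : ℝ≥0∞) := by
    intro a n h v
    rw [M.window_tsum a (a + n + 1) (n + 1) v _ _ ⟨n + 1, le_rfl, by push_cast; ring⟩]
    · simp only [h, Finset.prod_range_succ]
      have : ∀ s : S, (M.lam (Function.update v (a + n + 1) s a) : ℝ≥0∞) *
          ((∏ i ∈ Finset.range n, (M.P (Function.update v (a + n + 1) s (a + i))
            (Function.update v (a + n + 1) s (a + i + 1)) : ℝ≥0∞)) *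
            M.P (Function.update v (a + n + 1) s (a + n))
            (Function.update v (a + n + 1) s (a + n + 1))) =
          (M.lam (v a) * ∏ i ∈ Finset.range n, (M.P (v (a + i)) (v (a + i + 1)) : ℝ≥0∞)) *
            M.P (v (a + n)) s := by
        intro s
        rw [Function.update_self, Function.update_of_ne (by omega), Function.update_of_ne (by omega),
          mul_assoc]
        congr 2
        refine Finset.prod_congr rfl fun i hi => ?_
        have := Finset.mem_range.1 hi
        rw [Function.update_of_ne (by omega), Function.update_of_ne (by omega)]
      simp only [this, ENNReal.tsum_mul_left]
      rw [(ENNReal.hasSum_coe.2 (M.stochastic (v (a + n)))).tsum_eq]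
      simp
    · ext x
      constructor
      · intro h i hi e
        exact h i (by omega)
      · intro h i hi
        exact h i (by omega) (by omega)
  have dropL : ∀ (a : ℤ) (n : ℕ), (∀ v : ℤ → S,
      M.markovMeasure {x | ∀ i : ℕ, i ≤ n + 1 → x (a + i) = v (a + i)} =
      M.lam (v a) * ∏ i ∈ Finset.range (n + 1), (M.P (v (a + i)) (v (a + i + 1)) : ℝ≥0∞)) →
      ∀ v : ℤ → S, M.markovMeasure {x | ∀ i : ℕ, i ≤ n → x (a + 1 + i) = v (a + 1 + i)} =
      M.lam (v (a + 1)) *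
        ∏ i ∈ Finset.range n, (M.P (v (a + 1 + i)) (v (a + 1 + i + 1)) : ℝ≥0∞) := by
    intro a n h v
    rw [M.window_tsum a a (n + 1) v _ _ ⟨0, by omega, by simp⟩]
    · simp only [h, Finset.prod_range_succ']
      have : ∀ s : S, (M.lam (Function.update v a s a) : ℝ≥0∞) *
          ((∏ i ∈ Finset.range n, (M.P (Function.update v a s (a + (i + 1 : ℕ)))
            (Function.update v a s (a + (i + 1 : ℕ) + 1)) : ℝ≥0∞)) *
            M.P (Function.update v a s (a + (0 : ℕ)))
            (Function.update v a s (a + (0 : ℕ) + 1))) =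
          ((M.lam s * M.P s (v (a + 1)) : ℝ≥0) : ℝ≥0∞) *
          ∏ i ∈ Finset.range n, (M.P (v (a + 1 + i)) (v (a + 1 + i + 1)) : ℝ≥0∞) := by
        intro s
        have e0 : a + ((0 : ℕ) : ℤ) = a := by simp
        rw [e0, Function.update_self, Function.update_of_ne (by omega), ENNReal.coe_mul, mul_assoc,
          mul_comm (∏ i ∈ Finset.range n, _)]
        congr 2
        refine Finset.prod_congr rfl fun i hi => ?_
        have e : a + ((i + 1 : ℕ) : ℤ) = a + 1 + i := by push_cast; ring
        rw [e, Function.update_of_ne (by omega), Function.update_of_ne (by omega)]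
      simp only [this, ENNReal.tsum_mul_right]
      rw [(ENNReal.hasSum_coe.2 (M.lam_mul_P (v (a + 1)))).tsum_eq]
    · ext x
      constructor
      · intro h i hi e
        obtain ⟨k, rfl⟩ : ∃ k, i = k + 1 := ⟨i - 1, by omega⟩
        have := h k (by omega)
        have e : a + ((k + 1 : ℕ) : ℤ) = a + 1 + k := by push_cast; ring
        rwa [e]
      · intro h k hk
        have := h (k + 1) (by omega) (by omega)
        have e : a + ((k + 1 : ℕ) : ℤ) = a + 1 + k := by push_cast; ring
        rwa [e] at this
  have dropR' : ∀ (m : ℕ) (a : ℤ) (n : ℕ), (∀ v : ℤ → S,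
      M.markovMeasure {x | ∀ i : ℕ, i ≤ n + m → x (a + i) = v (a + i)} =
      M.lam (v a) * ∏ i ∈ Finset.range (n + m), (M.P (v (a + i)) (v (a + i + 1)) : ℝ≥0∞)) →
      ∀ v : ℤ → S, M.markovMeasure {x | ∀ i : ℕ, i ≤ n → x (a + i) = v (a + i)} =
      M.lam (v a) * ∏ i ∈ Finset.range n, (M.P (v (a + i)) (v (a + i + 1)) : ℝ≥0∞) := by
    intro m
    induction m with
    | zero => exact fun a n h => h
    | succ m ih => exact fun a n h => ih a n (dropR a (n + m) h)
  have dropL' : ∀ (m : ℕ) (a : ℤ) (n : ℕ), (∀ v : ℤ → S,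
      M.markovMeasure {x | ∀ i : ℕ, i ≤ n + m → x (a + i) = v (a + i)} =
      M.lam (v a) * ∏ i ∈ Finset.range (n + m), (M.P (v (a + i)) (v (a + i + 1)) : ℝ≥0∞)) →
      ∀ v : ℤ → S, M.markovMeasure {x | ∀ i : ℕ, i ≤ n → x (a + m + i) = v (a + m + i)} =
      M.lam (v (a + m)) *
        ∏ i ∈ Finset.range n, (M.P (v (a + m + i)) (v (a + m + i + 1)) : ℝ≥0∞) := by
    intro m
    induction m with
    | zero => intro a n h v; simpa using h v
    | succ m ih =>
      intro a n h v
      have := ih (a + 1) n (dropL a (n + m) h) v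
      have e : a + ((m + 1 : ℕ) : ℤ) = a + 1 + m := by push_cast; ring
      rwa [e]
  obtain ⟨m, hm⟩ : ∃ m : ℕ, (a + a.natAbs : ℤ) = m := ⟨(a + a.natAbs).toNat, by omega⟩
  have ha : (-(a.natAbs : ℤ)) + m = a := by omega
  have := dropL' m (-(a.natAbs : ℤ)) n
    (dropR' a.natAbs _ _ fun v => by
      have h := M.window_zero v a.natAbs (n + m)
      rwa [show a.natAbs + (n + m) = n + m + a.natAbs by ring] at h) v
  rwa [ha] at this

/-- The mass of the cylinder `[s₀, …, s_k]` at the times `l, …, l + k`. -/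
theorem markovMeasure_cylinder (l : ℤ) (k : ℕ) (s : ℕ → S) :
    M.markovMeasure {x | ∀ i : ℕ, i ≤ k → x (l + i) = s i} =
      M.lam (s 0) * ∏ i ∈ Finset.range k, (M.P (s i) (s (i + 1)) : ℝ≥0∞) := by
  have h := M.window (fun j => s (j - l).toNat) l k
  have e : ∀ i : ℕ, (l + i - l).toNat = i := fun i => by omega
  have e' : ∀ i : ℕ, (l + i + 1 - l).toNat = i + 1 := fun i => by omega
  simpa [e, e'] using h

instance markovMeasure_sigmaFinite : SigmaFinite M.markovMeasure := by
  refine Measure.sigmaFinite_of_countable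
    (S := Set.range fun s : S => {x : ℤ → S | x 0 = s}) (Set.countable_range _) ?_ ?_
  · rintro _ ⟨s, rfl⟩
    have h := M.markovMeasure_cylinder 0 0 (fun _ => s)
    simp only [Nat.le_zero, forall_eq, Nat.cast_zero, add_zero, Finset.range_zero,
      Finset.prod_empty, mul_one] at h
    exact h ▸ ENNReal.coe_lt_top
  · ext x; simp

/-- The product measure on `(S^ℤ)^k` of `k` copies of the Markov measure. -/
noncomputable def powerMeasure (k : ℕ) : Measure (Fin k → ℤ → S) :=
  Measure.pi fun _ => M.markovMeasure

end InfiniteMarkovData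

/-! ### Conservativity and ergodicity of stationary Markov measures -/

open Filter

section Paths

variable {E : Type*}

/-! Reversing the paths of the last `k - m` coordinates conjugates `mixedShift k m` to the shift on
two-sided paths in `S^k`. The image measure is again a stationary Markov measure, because
independence of future and past given the present is symmetric under time reversal and passes to
products.

For such a measure `ν` charging every state, `conservative_and_ergodic_iff` says that the shift is
conservative and ergodic exactly when the series `∑ ν(x₀ = a, xₙ = b)` diverges for all `a`, `b`.
The `n`-th term is a product over the coordinates. A reversed coordinate contributes `μ(x₀ = bᵢ, xₙ
= aᵢ)` in place of `μ(x₀ = aᵢ, xₙ = bᵢ)`. Exchanging `aᵢ` and `bᵢ` for `i ≥ m` permutes the pairs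
`(a, b)`, so the criterion is the same for every `m`, in particular for `m = k`.

Necessity in the criterion is Borel–Cantelli: under conservativity and ergodicity almost every path
visits `b` infinitely often. For sufficiency, divergence on the diagonal gives recurrence
(`ae_exists_return`), hence conservativity. Recurrence also lets an invariant set be approximated,
over `x₀ = e`, by events of the future alone (`approx_future`) and, by reversal, of the past alone.
Given `x₀ = e` these are independent, so the invariant set is independent of itself there
(`zero_one`). Divergence off the diagonal makes all states communicate, which forces the same
alternative at each of them. -/

/-- The `n`-th power of the left shift on two-sided sequences. -/
def shiftBy (n : ℤ) (x : ℤ → E) (j : ℤ) : E := x (j + n)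

/-- Time reversal of two-sided sequences. -/
def reversal (x : ℤ → E) (j : ℤ) : E := x (-j)

theorem shiftBy_iterate (n : ℕ) : (shiftBy (E := E) 1)^[n] = shiftBy (n : ℤ) := by
  induction n with
  | zero => ext x j; simp [shiftBy]
  | succ n ih =>
    ext x j
    rw [Function.iterate_succ_apply', ih]
    simp only [shiftBy]
    congr 1; push_cast; ring

theorem shiftBy_mem_iff {I : Set (ℤ → E)} (hI : shiftBy 1 ⁻¹' I = I) (n : ℕ) (x : ℤ → E) :
    shiftBy n x ∈ I ↔ x ∈ I := by
  have h : (shiftBy 1)^[n] ⁻¹' I = I := by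
    induction n with
    | zero => simp
    | succ n ih => rw [Function.iterate_succ, Set.preimage_comp, ih, hI]
  rw [shiftBy_iterate] at h
  exact Set.ext_iff.1 h x

variable [MeasurableSpace E]

theorem measurable_shiftBy (n : ℤ) : Measurable (shiftBy (E := E) n) :=
  measurable_pi_lambda _ fun j => measurable_pi_apply (j + n)

theorem measurable_reversal : Measurable (reversal (E := E)) :=
  measurable_pi_lambda _ fun j => measurable_pi_apply (-j)

/-- A shift-invariant measure on two-sided sequences, finite on the sets where the state at time
`0` is prescribed, for which the future and the past are independent given the present. -/
structure IsStationaryMarkov (ν : Measure (ℤ → E)) : Prop where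
  measurePreserving : MeasurePreserving (shiftBy 1) ν ν
  measure_ne_top : ∀ e, ν {x | x 0 = e} ≠ ∞
  indep : ∀ (e : E) (F G : Set (ℕ → E)), MeasurableSet F → MeasurableSet G →
    ν {x | x 0 = e ∧ (fun n : ℕ => x n) ∈ F ∧ (fun n : ℕ => x (-n)) ∈ G} * ν {x | x 0 = e} =
      ν {x | x 0 = e ∧ (fun n : ℕ => x n) ∈ F} * ν {x | x 0 = e ∧ (fun n : ℕ => x (-n)) ∈ G}

theorem measurable_eval_eq [MeasurableSingletonClass E] {ι : Type*} (i : ι) (e : E) :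
    Measurable fun x : ι → E => x i = e :=
  Measurable.comp (g := fun a => a = e) (measurableSet_setOfPred.1 (measurableSet_singleton e))
    (measurable_pi_apply i)

end Paths

/-! ### Recurrence, the zero-one law and the divergence criterion -/

namespace IsStationaryMarkov

variable {E : Type*} [MeasurableSpace E] {ν : Measure (ℤ → E)}

theorem measurePreserving_shiftBy (h : IsStationaryMarkov ν) (n : ℕ) :
    MeasurePreserving (shiftBy (n : ℤ)) ν ν := by
  rw [← shiftBy_iterate]; exact h.measurePreserving.iterate n

theorem measurePreserving_shiftBy_neg_one (h : IsStationaryMarkov ν) :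
    MeasurePreserving (shiftBy (-1)) ν ν := by
  refine ⟨measurable_shiftBy _, ?_⟩
  conv_lhs => rw [← h.measurePreserving.map_eq]
  rw [Measure.map_map (measurable_shiftBy _) (measurable_shiftBy _)]
  convert Measure.map_id
  ext x j; simp [shiftBy]

/-- Invariance carries the return property from time `0` to every time `n`, so each visit is almost
surely followed by a later one. -/
theorem ae_frequently_return (h : IsStationaryMarkov ν) (e : E)
    (hret : ∀ᵐ x ∂ν, x 0 = e → ∃ n : ℕ, 0 < n ∧ x n = e) :
    ∀ᵐ x ∂ν, x 0 = e → ∃ᶠ n : ℕ in atTop, x n = e := by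
  have h1 : ∀ᵐ x ∂ν, ∀ n : ℕ, x n = e → ∃ m : ℕ, n < m ∧ x m = e := by
    rw [ae_all_iff]
    intro n
    filter_upwards [(h.measurePreserving_shiftBy n).quasiMeasurePreserving.ae hret] with x hx hn
    obtain ⟨m, hm, hx⟩ := hx (by simpa [shiftBy] using hn)
    exact ⟨m + n, by omega, by simpa [shiftBy] using hx⟩
  filter_upwards [h1] with x hx hx0
  rw [frequently_atTop]
  intro a
  induction a with
  | zero => exact ⟨0, le_rfl, by simpa using hx0⟩
  | succ a ih =>
    obtain ⟨b, hb, hxb⟩ := ih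
    obtain ⟨m, hm, hxm⟩ := hx b hxb
    exact ⟨m, by omega, hxm⟩

/-- A measurable set of paths is approximated by events depending on the times `≥ -N`. -/
theorem approx_window [IsFiniteMeasure ν] {I : Set (ℤ → E)} (mI : MeasurableSet I)
    {ε : ℝ} (hε : 0 < ε) : ∃ (N : ℕ) (F : Set (ℕ → E)), MeasurableSet F ∧
      ν (symmDiff I {x | (fun j : ℕ => x (j - N)) ∈ F}) < ENNReal.ofReal ε := by
  set 𝒜 : Set (Set (ℤ → E)) := {s | ∃ (N : ℕ) (F : Set (ℕ → E)), MeasurableSet F ∧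
    s = {x | (fun j : ℕ => x (j - N)) ∈ F}} with h𝒜
  -- An event read from time `-N` on can also be read from any earlier time, so two members of `𝒜`
  -- can be given a common window; this yields closure under unions.
  have hmono : ∀ (N M : ℕ) (F : Set (ℕ → E)), N ≤ M → MeasurableSet F →
      ∃ F' : Set (ℕ → E), MeasurableSet F' ∧ {x : ℤ → E | (fun j : ℕ => x (j - N)) ∈ F} =
        {x | (fun j : ℕ => x (j - M)) ∈ F'} := by
    intro N M F hNM hF
    have hm : Measurable fun (w : ℕ → E) (j : ℕ) => w (j + (M - N)) := by fun_prop
    refine ⟨_, hm hF, ?_⟩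
    ext x
    simp only [Set.mem_ofPred_eq, Set.mem_preimage]
    have : (fun j : ℕ => x (j - N)) = fun j : ℕ => x ((j + (M - N) : ℕ) - M) := by
      funext j; congr 1; omega
    rw [this]
  have halg : IsSetAlgebra 𝒜 := by
    refine ⟨⟨0, ∅, .empty, by simp⟩, ?_, ?_⟩
    · rintro _ ⟨N, F, hF, rfl⟩
      exact ⟨N, Fᶜ, hF.compl, rfl⟩
    · rintro _ _ ⟨N, F, hF, rfl⟩ ⟨M, G, hG, rfl⟩
      obtain ⟨F', hF', e1⟩ := hmono N (max N M) F (le_max_left _ _) hF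
      obtain ⟨G', hG', e2⟩ := hmono M (max N M) G (le_max_right _ _) hG
      rw [e1, e2]
      exact ⟨max N M, F' ∪ G', hF'.union hG', rfl⟩
  have hgen : (MeasurableSpace.pi : MeasurableSpace (ℤ → E)) =
      MeasurableSpace.generateFrom 𝒜 := by
    refine le_antisymm ?_ (MeasurableSpace.generateFrom_le ?_)
    · refine iSup_le fun i => ?_
      rintro _ ⟨s, hs, rfl⟩
      refine MeasurableSpace.measurableSet_generateFrom
        ⟨i.natAbs, {w | w (i + i.natAbs).toNat ∈ s}, measurable_pi_apply _ hs, ?_⟩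
      ext x
      simp only [Set.mem_preimage, Set.mem_ofPred_eq]
      have : (((i + i.natAbs).toNat : ℕ) : ℤ) - i.natAbs = i := by omega
      rw [this]
    · rintro _ ⟨N, F, hF, rfl⟩
      have hm : Measurable fun (x : ℤ → E) (j : ℕ) => x (j - N) := by fun_prop
      exact hm hF
  obtain ⟨_, ⟨N, F, hF, rfl⟩, ht⟩ :=
    (Measure.MeasureDense.of_generateFrom_isSetAlgebra_finite (μ := ν) halg hgen).approx I mI
      (MeasureTheory.measure_ne_top ν I) ε hε
  exact ⟨N, F, hF, ht⟩

variable [MeasurableSingletonClass E]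

theorem measurableSet_zero (e : E) : MeasurableSet {x : ℤ → E | x 0 = e} :=
  measurableSet_setOfPred.2 (measurable_eval_eq 0 e)

/-- Conditional independence is symmetric in future and past, and the inverse shift also preserves
`ν`. Statements about the future thereby yield statements about the past. -/
theorem map_reversal (h : IsStationaryMarkov ν) : IsStationaryMarkov (ν.map reversal) := by
  have hA : ∀ e : E, (ν.map reversal) {x | x 0 = e} = ν {x | x 0 = e} := fun e => by
    rw [Measure.map_apply measurable_reversal (measurableSet_zero e)]
    rfl
  refine ⟨⟨measurable_shiftBy _, ?_⟩, fun e => (hA e).trans_ne (h.measure_ne_top e), ?_⟩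
  · rw [Measure.map_map (measurable_shiftBy _) measurable_reversal]
    conv_rhs => rw [← h.measurePreserving_shiftBy_neg_one.map_eq,
      Measure.map_map measurable_reversal (measurable_shiftBy _)]
    congr 1
    ext x j
    simp only [shiftBy, reversal, Function.comp]
    congr 1; ring
  · intro e F G hF hG
    have hf : Measurable fun (x : ℤ → E) (n : ℕ) => x n := by fun_prop
    have hg : Measurable fun (x : ℤ → E) (n : ℕ) => x (-n) := by fun_prop
    have m0 := measurableSet_zero e
    have m1 : MeasurableSet {x : ℤ → E | x 0 = e ∧ (fun n : ℕ => x n) ∈ F} := m0.inter (hf hF)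
    have m2 : MeasurableSet {x : ℤ → E | x 0 = e ∧ (fun n : ℕ => x (-n)) ∈ G} := m0.inter (hg hG)
    have m3 : MeasurableSet {x : ℤ → E | x 0 = e ∧ (fun n : ℕ => x n) ∈ F ∧
        (fun n : ℕ => x (-n)) ∈ G} := m0.inter ((hf hF).inter (hg hG))
    rw [hA, Measure.map_apply measurable_reversal m1, Measure.map_apply measurable_reversal m2,
      Measure.map_apply measurable_reversal m3, mul_comm (ν (_ ⁻¹' _)) (ν (_ ⁻¹' _))]
    have := h.indep e G F hG hF
    simp only [reversal, Set.preimage_ofPred_eq, neg_zero, neg_neg]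
    rw [← this]
    simp only [and_comm (a := _ ∈ G)]

/-- The chain starting from a recurrent state almost surely returns there. -/
theorem ae_exists_return (h : IsStationaryMarkov ν) (e : E)
    (hrec : ∑' n : ℕ, ν {x | x 0 = e ∧ x n = e} = ∞) :
    ∀ᵐ x ∂ν, x 0 = e → ∃ n : ℕ, 0 < n ∧ x n = e := by
  set A : Set (ℤ → E) := {x | x 0 = e} with hA
  have mA : MeasurableSet A := measurableSet_zero e
  set F : Set (ℕ → E) := {w | ∀ n, 0 < n → w n ≠ e} with hF
  have mF : MeasurableSet F := measurableSet_setOfPred.2 <|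
    Measurable.forall fun n => Measurable.imp measurable_const (measurable_eval_eq n e).not
  have hf : Measurable fun (x : ℤ → E) (n : ℕ) => x n := by fun_prop
  set W : Set (ℤ → E) := {x | x 0 = e ∧ (fun n : ℕ => x n) ∈ F} with hW
  have mW : MeasurableSet W := mA.inter (hf mF)
  -- `W` is the event of starting at `e` and never returning, so the set on the left says that the
  -- last visit to `e` is at time `n`. Seen from time `n`, this is a future without return and a
  -- past with a visit at `-n`.
  have key : ∀ n : ℕ, ν (A ∩ shiftBy n ⁻¹' W) * ν A = ν W * ν {x | x 0 = e ∧ x n = e} := by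
    intro n
    have mG : MeasurableSet {w : ℕ → E | w n = e} := measurableSet_setOfPred.2 (measurable_eval_eq n e)
    have hg : Measurable fun (x : ℤ → E) (n : ℕ) => x (-n) := by fun_prop
    have h1 := h.indep e F {w | w n = e} mF mG
    have m1 : MeasurableSet {x : ℤ → E | x 0 = e ∧ (fun n : ℕ => x n) ∈ F ∧
        (fun n : ℕ => x (-n)) ∈ {w : ℕ → E | w n = e}} := mA.inter ((hf mF).inter (hg mG))
    have m2 : MeasurableSet {x : ℤ → E | x 0 = e ∧
        (fun n : ℕ => x (-n)) ∈ {w : ℕ → E | w n = e}} := mA.inter (hg mG)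
    rw [← (h.measurePreserving_shiftBy n).measure_preimage m1.nullMeasurableSet,
      ← (h.measurePreserving_shiftBy n).measure_preimage m2.nullMeasurableSet] at h1
    convert h1 using 3
    · ext x
      simp only [hA, hW, shiftBy, Set.mem_inter_iff, Set.mem_preimage, Set.mem_ofPred_eq]
      simp
      tauto
    · ext x
      simp only [shiftBy, Set.mem_preimage, Set.mem_ofPred_eq]
      simp
      tauto
  have hdisj : Pairwise (Function.onFun Disjoint fun n : ℕ => A ∩ shiftBy (n : ℤ) ⁻¹' W) := by
    refine (pairwise_disjoint_on _).2 fun n m hnm => ?_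
    refine Set.disjoint_left.2 fun x hx hy => hx.2.2 (m - n) (by omega) ?_
    have := hy.2.1
    simp only [shiftBy] at this ⊢
    rw [← this]; congr 1; omega
  have hsum : ∑' n : ℕ, ν (A ∩ shiftBy n ⁻¹' W) ≤ ν A :=
    (tsum_meas_le_meas_iUnion_of_disjoint ν
      (fun n => mA.inter (measurable_shiftBy _ mW)) hdisj).trans
      (measure_mono (Set.iUnion_subset fun n => Set.inter_subset_left))
  -- Summing `key` over `n`: the last visit is unique, so the left side stays finite, while the
  -- right side is `ν W * ∞`.
  have h0 : ν W = 0 := by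
    by_contra hne
    have h2 : (∑' n : ℕ, ν (A ∩ shiftBy n ⁻¹' W)) * ν A = ∞ := by
      rw [← ENNReal.tsum_mul_right]
      simp only [key]
      rw [ENNReal.tsum_mul_left, hrec, ENNReal.mul_top hne]
    exact ENNReal.mul_ne_top (hsum.trans_lt (h.measure_ne_top e).lt_top).ne (h.measure_ne_top e) h2
  have h3 : ∀ᵐ x ∂ν, x ∉ W := measure_eq_zero_iff_ae_notMem.1 h0
  filter_upwards [h3] with x hx hx0
  by_contra! hc
  exact hx ⟨hx0, hc⟩

/-- A shift-invariant measure on paths is conservative if every state is visited infinitely often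
by almost every path starting there. -/
theorem conservative [Countable E] (h : IsStationaryMarkov ν)
    (hret : ∀ e, ∀ᵐ x ∂ν, x 0 = e → ∃ᶠ n : ℕ in atTop, x n = e) :
    Conservative (shiftBy 1) ν := by
  refine ⟨h.measurePreserving.quasiMeasurePreserving, fun s ms hs => ?_⟩
  by_contra! hc
  apply hs
  have hU : s = ⋃ e, s ∩ {x | x 0 = e} := by ext x; simp
  rw [hU, measure_iUnion_null_iff]
  intro e
  set W := s ∩ {x : ℤ → E | x 0 = e} with hW
  have mA := measurableSet_zero e
  have mW : MeasurableSet W := ms.inter mA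
  -- Moved by the `n`-th power of the shift, these events become disjoint parts of `{x | x 0 = e}`,
  -- since an orbit meets the wandering set `s` at most once. By Borel–Cantelli almost every path in
  -- `W` then visits `e` only finitely often.
  have hsum : ∑' n : ℕ, ν {x | x ∈ W ∧ x n = e} ≤ ν {x : ℤ → E | x 0 = e} := by
    have e1 : ∀ n : ℕ, ν {x | x ∈ W ∧ x n = e} = ν ({x | x 0 = e} ∩ shiftBy (-n) ⁻¹' W) := by
      intro n
      rw [← (h.measurePreserving_shiftBy n).measure_preimage
        (mA.inter (measurable_shiftBy _ mW)).nullMeasurableSet]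
      congr 1
      ext x
      have : shiftBy (-n : ℤ) (shiftBy n x) = x := by ext j; simp [shiftBy]
      simp only [Set.mem_ofPred_eq, Set.mem_preimage, Set.mem_inter_iff, this]
      simp [shiftBy, and_comm]
    simp only [e1]
    refine (tsum_meas_le_meas_iUnion_of_disjoint ν
      (fun n => mA.inter (measurable_shiftBy _ mW)) ?_).trans
      (measure_mono (Set.iUnion_subset fun n => Set.inter_subset_left))
    refine (pairwise_disjoint_on _).2 fun n m hnm => ?_
    refine Set.disjoint_left.2 fun x hx hy => ?_
    refine hc (shiftBy (-m : ℤ) x) hy.2.1 (m - n) (by omega) ?_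
    rw [shiftBy_iterate]
    convert hx.2.1 using 1
    ext j
    simp only [shiftBy]
    congr 1; omega
  have hbc := ae_eventually_notMem (hsum.trans_lt (h.measure_ne_top e).lt_top).ne
  rw [measure_eq_zero_iff_ae_notMem]
  filter_upwards [hbc, hret e] with x h1 h2 hx
  obtain ⟨n, h3, h4⟩ := ((h2 hx.2).and_eventually h1).exists
  exact h4 ⟨hx, h3⟩

/-- Composition with the first return map to a state shortens by one the piece of the past needed
to approximate an invariant set. -/
theorem approx_shorten (h : IsStationaryMarkov ν) (e : E)
    (hret : ∀ᵐ x ∂ν, x 0 = e → ∃ n : ℕ, 0 < n ∧ x n = e)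
    {I : Set (ℤ → E)} (mI : MeasurableSet I) (hI : shiftBy 1 ⁻¹' I = I)
    (N : ℕ) {F : Set (ℕ → E)} (hF : MeasurableSet F) :
    ∃ F' : Set (ℕ → E), MeasurableSet F' ∧
      ν ({x | x 0 = e} ∩ symmDiff I {x | (fun j : ℕ => x (j - N)) ∈ F'}) ≤
      ν ({x | x 0 = e} ∩ symmDiff I {x | (fun j : ℕ => x (j - (N + 1 : ℕ))) ∈ F}) := by
  set C : Set (ℤ → E) := {x | (fun j : ℕ => x (j - (N + 1 : ℕ))) ∈ F} with hC
  set D : Set (ℤ → E) := {x | x 0 = e} ∩ symmDiff I C with hD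
  have mC : MeasurableSet C := by
    have hm : Measurable fun (x : ℤ → E) (j : ℕ) => x (j - (N + 1 : ℕ)) := by fun_prop
    exact hm hF
  have mD : MeasurableSet D := (measurableSet_zero e).inter (mI.symmDiff mC)
  -- Index `N + i` of `w` is time `i` of the path, and `n` is the first return time. The window of
  -- the path shifted by `n` starts at time `n - (N + 1)`, which is index `n - 1` here; since `n ≥
  -- 1`, no time before `-N` is needed.
  set F' : Set (ℕ → E) := {w | ∃ n : ℕ, 0 < n ∧ w (N + n) = e ∧
    (∀ i, 0 < i → i < n → w (N + i) ≠ e) ∧ (fun j => w (j + (n - 1))) ∈ F} with hF'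
  have mF' : MeasurableSet F' := by
    refine measurableSet_setOfPred.2 (Measurable.exists fun n => measurable_const.and
      ((measurable_eval_eq _ e).and (Measurable.and (Measurable.forall fun i =>
        Measurable.imp measurable_const (Measurable.imp measurable_const
          (measurable_eval_eq _ e).not)) ?_)))
    have hm : Measurable fun (w : ℕ → E) (j : ℕ) => w (j + (n - 1)) := by fun_prop
    exact measurableSet_setOfPred.1 (hm hF)
  refine ⟨F', mF', ?_⟩
  -- The points of the old error set `D` whose previous visit to `e` is at time `-n`. The new error
  -- points with first return time `n` are sent into `B n` by `shiftBy n`, because `I` is invariant;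
  -- disjointness of the `B n` bounds the total error by `ν D`.
  set B : ℕ → Set (ℤ → E) := fun n => {y | 0 < n ∧ y (-n) = e ∧
    (∀ i : ℕ, 0 < i → i < n → y (i - n) ≠ e) ∧ y ∈ D} with hB
  have mB : ∀ n, MeasurableSet (B n) := fun n =>
    measurableSet_setOfPred.2 (measurable_const.and ((measurable_eval_eq _ e).and
      (Measurable.and (Measurable.forall fun i => Measurable.imp measurable_const
        (Measurable.imp measurable_const (measurable_eval_eq _ e).not))
        (measurableSet_setOfPred.1 mD))))
  have hdisj : Pairwise (Function.onFun Disjoint B) := by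
    refine (pairwise_disjoint_on _).2 fun n m hnm => ?_
    refine Set.disjoint_left.2 fun y hy hy' => hy'.2.2.1 (m - n) (by omega) ?_ ?_
    · have := hy.1; omega
    · rw [← hy.2.1]; congr 1; omega
  have hsub : ∀ᵐ x ∂ν, x ∈ {x | x 0 = e} ∩ symmDiff I {x | (fun j : ℕ => x (j - N)) ∈ F'} →
      x ∈ ⋃ n : ℕ, shiftBy n ⁻¹' B n := by
    filter_upwards [hret] with x hx hx'
    obtain ⟨hx0, hxd⟩ := hx'
    classical
    have hex := hx hx0
    set n := Nat.find hex with hn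
    obtain ⟨hn0, hne⟩ : 0 < n ∧ x n = e := Nat.find_spec hex
    have hfirst : ∀ i : ℕ, 0 < i → i < n → x i ≠ e := fun i hi hin hie =>
      Nat.find_min hex hin ⟨hi, hie⟩
    have hiff : (fun j : ℕ => x (j - N)) ∈ F' ↔ shiftBy n x ∈ C := by
      have e0 : ∀ i : ℕ, ((N + i : ℕ) : ℤ) - N = i := fun i => by push_cast; ring
      have e1 : ∀ n : ℕ, 0 < n → (fun j : ℕ => x ((j + (n - 1) : ℕ) - N)) =
          fun j : ℕ => shiftBy n x (j - (N + 1 : ℕ)) := by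
        intro n hn
        funext j; simp only [shiftBy]; congr 1; omega
      simp only [hF', hC, Set.mem_ofPred_eq, e0]
      constructor
      · rintro ⟨m, hm0, hme, hm, hmF⟩
        have : m = n := by
          rcases lt_trichotomy m n with hlt | heq | hlt
          · exact absurd hme (hfirst m hm0 hlt)
          · exact heq
          · exact absurd hne (hm n hn0 hlt)
        rw [← this, ← e1 m hm0]
        exact hmF
      · intro hF
        exact ⟨n, hn0, hne, hfirst, by rwa [e1 n hn0]⟩
    have hxI := shiftBy_mem_iff hI n x
    refine Set.mem_iUnion.2 ⟨n, hn0, ?_, ?_, ?_, ?_⟩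
    · simpa [shiftBy] using hx0
    · intro i hi hin
      simpa [shiftBy] using hfirst i hi hin
    · simpa [shiftBy] using hne
    · rw [Set.mem_symmDiff] at hxd ⊢
      simp only [Set.mem_ofPred_eq] at hxd
      rw [hiff] at hxd
      tauto
  calc _ ≤ ν (⋃ n : ℕ, shiftBy n ⁻¹' B n) := measure_mono_ae hsub
    _ ≤ ∑' n : ℕ, ν (shiftBy n ⁻¹' B n) := measure_iUnion_le _
    _ = ∑' n : ℕ, ν (B n) := by
      congr with n
      exact (h.measurePreserving_shiftBy n).measure_preimage (mB n).nullMeasurableSet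
    _ ≤ ν (⋃ n, B n) := tsum_meas_le_meas_iUnion_of_disjoint ν mB hdisj
    _ ≤ ν D := measure_mono (Set.iUnion_subset fun n y hy => hy.2.2.2)

/-- Invariant sets are, over a recurrent state, approximated by events of the future. -/
theorem approx_future (h : IsStationaryMarkov ν) (e : E)
    (hret : ∀ᵐ x ∂ν, x 0 = e → ∃ n : ℕ, 0 < n ∧ x n = e)
    {I : Set (ℤ → E)} (mI : MeasurableSet I) (hI : shiftBy 1 ⁻¹' I = I)
    {ε : ℝ} (hε : 0 < ε) : ∃ F : Set (ℕ → E), MeasurableSet F ∧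
      ν ({x | x 0 = e} ∩ symmDiff I {x | (fun j : ℕ => x j) ∈ F}) < ENNReal.ofReal ε := by
  have hstep : ∀ (N : ℕ) (F : Set (ℕ → E)), MeasurableSet F →
      ∃ F' : Set (ℕ → E), MeasurableSet F' ∧
        ν ({x | x 0 = e} ∩ symmDiff I {x | (fun j : ℕ => x j) ∈ F'}) ≤
        ν ({x | x 0 = e} ∩ symmDiff I {x | (fun j : ℕ => x (j - N)) ∈ F}) := by
    intro N
    induction N with
    | zero => intro F hF; exact ⟨F, hF, by simp⟩
    | succ N ih =>
      intro F hF
      obtain ⟨F₁, hF₁, h₁⟩ := h.approx_shorten e hret mI hI N hF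
      obtain ⟨F₂, hF₂, h₂⟩ := ih F₁ hF₁
      exact ⟨F₂, hF₂, h₂.trans h₁⟩
  have : IsFiniteMeasure (ν.restrict {x | x 0 = e}) :=
    isFiniteMeasure_restrict.2 (h.measure_ne_top e)
  obtain ⟨N, F, hF, hlt⟩ := approx_window (ν := ν.restrict {x | x 0 = e}) mI hε
  rw [Measure.restrict_apply' (measurableSet_zero e), Set.inter_comm] at hlt
  obtain ⟨F', hF', hle⟩ := hstep N F hF
  exact ⟨F', hF', hle.trans_lt hlt⟩

/-- Over a recurrent state, invariant sets are trivial. -/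
theorem zero_one (h : IsStationaryMarkov ν) (e : E)
    (hrec : ∑' n : ℕ, ν {x | x 0 = e ∧ x n = e} = ∞)
    {I : Set (ℤ → E)} (mI : MeasurableSet I) (hI : shiftBy 1 ⁻¹' I = I) :
    ν ({x | x 0 = e} ∩ I) = 0 ∨ ν ({x | x 0 = e} ∩ Iᶜ) = 0 := by
  have mA := measurableSet_zero e
  have hret := h.ae_exists_return e hrec
  -- By stationarity the reversed measure has the same diagonal series, so it is recurrent at `e` as
  -- well.
  have hret' : ∀ᵐ x ∂(ν.map reversal), x 0 = e → ∃ n : ℕ, 0 < n ∧ x n = e := by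
    refine h.map_reversal.ae_exists_return e ?_
    rw [← hrec]
    congr with n
    have m1 : MeasurableSet {x : ℤ → E | x 0 = e ∧ x n = e} :=
      mA.inter (measurableSet_setOfPred.2 (measurable_eval_eq _ e))
    have m2 : MeasurableSet (reversal ⁻¹' {x : ℤ → E | x 0 = e ∧ x n = e}) :=
      measurable_reversal m1
    rw [Measure.map_apply measurable_reversal m1,
      ← (h.measurePreserving_shiftBy n).measure_preimage m2.nullMeasurableSet]
    congr 1
    ext x
    simp [reversal, shiftBy, and_comm]
  set ρ := ν.restrict {x : ℤ → E | x 0 = e} with hρ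
  have : IsFiniteMeasure ρ := isFiniteMeasure_restrict.2 (h.measure_ne_top e)
  have hf : Measurable fun (x : ℤ → E) (n : ℕ) => x n := by fun_prop
  have hreal : ∀ {s : Set (ℤ → E)} {ε : ℝ}, 0 < ε →
      ν ({x | x 0 = e} ∩ s) < ENNReal.ofReal ε → ρ.real s ≤ ε := by
    intro s ε hε hs
    rw [Measure.real, hρ, Measure.restrict_apply' mA, Set.inter_comm]
    exact ENNReal.toReal_le_of_le_ofReal hε.le hs.le
  set p := ρ.real I with hp
  set a := ρ.real Set.univ with ha
  -- With `I` within `ε` of a future event `F₁` and of a past event `G₁`, compare `p` with the mass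
  -- of `F₁ ∩ G₁`, which factorises by conditional independence. Letting `ε → 0` gives `p * a ≤ p *
  -- p`, where `0 ≤ p ≤ a`.
  have hε : ∀ ε : ℝ, 0 < ε → p * a ≤ (p + ε) * (p + ε) + 2 * ε * a := by
    intro ε hε
    obtain ⟨F, mF, hF⟩ := h.approx_future e hret mI hI hε
    have hI' : shiftBy 1 ⁻¹' (reversal ⁻¹' I) = reversal ⁻¹' I := by
      ext x
      simp only [Set.mem_preimage]
      have h1 : shiftBy 1 (reversal (shiftBy 1 x)) = reversal x := by
        ext j; simp only [shiftBy, reversal]; congr 1; ring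
      rw [← h1]
      exact (shiftBy_mem_iff hI 1 _).symm
    obtain ⟨G, mG, hG⟩ := h.map_reversal.approx_future e hret' (measurable_reversal mI) hI' hε
    rw [Measure.map_apply measurable_reversal
      (show MeasurableSet ({x : ℤ → E | x 0 = e} ∩
        symmDiff (reversal ⁻¹' I) {x | (fun j : ℕ => x j) ∈ G}) from
        mA.inter ((measurable_reversal mI).symmDiff (hf mG)))] at hG
    have eG : reversal ⁻¹' ({x : ℤ → E | x 0 = e} ∩
        symmDiff (reversal ⁻¹' I) {x | (fun j : ℕ => x j) ∈ G}) =
        {x | x 0 = e} ∩ symmDiff I {x | (fun j : ℕ => x (-j)) ∈ G} := by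
      ext x
      have : reversal (reversal x) = x := by ext j; simp [reversal]
      simp only [Set.mem_preimage, Set.mem_inter_iff, Set.mem_symmDiff, Set.mem_ofPred_eq, this]
      simp [reversal]
    rw [eG] at hG
    set F₁ : Set (ℤ → E) := {x | (fun j : ℕ => x j) ∈ F} with hF₁
    set G₁ : Set (ℤ → E) := {x | (fun j : ℕ => x (-j)) ∈ G} with hG₁
    have dF := hreal hε hF
    have dG := hreal hε hG
    have h1 : ρ.real F₁ ≤ p + ε := by
      have : ρ.real F₁ ≤ ρ.real (I ∪ symmDiff I F₁) := measureReal_mono fun x hx => by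
        rw [Set.mem_union, Set.mem_symmDiff]; tauto
      linarith [measureReal_union_le (μ := ρ) I (symmDiff I F₁)]
    have h2 : ρ.real G₁ ≤ p + ε := by
      have : ρ.real G₁ ≤ ρ.real (I ∪ symmDiff I G₁) := measureReal_mono fun x hx => by
        rw [Set.mem_union, Set.mem_symmDiff]; tauto
      linarith [measureReal_union_le (μ := ρ) I (symmDiff I G₁)]
    have h3 : p ≤ ρ.real (F₁ ∩ G₁) + 2 * ε := by
      have : p ≤ ρ.real (F₁ ∩ G₁ ∪ (symmDiff I F₁ ∪ symmDiff I G₁)) := measureReal_mono fun x hx => by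
        simp only [Set.mem_union, Set.mem_symmDiff, Set.mem_inter_iff]; tauto
      linarith [measureReal_union_le (μ := ρ) (F₁ ∩ G₁) (symmDiff I F₁ ∪ symmDiff I G₁),
        measureReal_union_le (μ := ρ) (symmDiff I F₁) (symmDiff I G₁)]
    have h4 : ρ.real (F₁ ∩ G₁) * a = ρ.real F₁ * ρ.real G₁ := by
      have := congrArg ENNReal.toReal (h.indep e F G mF mG)
      simp only [ENNReal.toReal_mul] at this
      simp only [Measure.real, ha, hρ, Measure.restrict_apply' mA, Set.univ_inter]
      convert this using 3
      · congr 1; ext x; simp only [Set.mem_inter_iff, hF₁, hG₁, Set.mem_ofPred_eq]; tauto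
      · congr 1; ext x; simp only [Set.mem_inter_iff, hF₁, Set.mem_ofPred_eq]; tauto
      · congr 1; ext x; simp only [Set.mem_inter_iff, hG₁, Set.mem_ofPred_eq]; tauto
    have ha0 : 0 ≤ a := measureReal_nonneg
    have hp0 : 0 ≤ p := measureReal_nonneg
    calc p * a ≤ (ρ.real (F₁ ∩ G₁) + 2 * ε) * a := by gcongr
      _ = ρ.real F₁ * ρ.real G₁ + 2 * ε * a := by rw [add_mul, h4]
      _ ≤ _ := by gcongr
  have hlim : p * a ≤ p * p := by
    have hc : Tendsto (fun ε : ℝ => (p + ε) * (p + ε) + 2 * ε * a) (nhdsWithin 0 (Set.Ioi 0))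
        (nhds (p * p)) := by
      have : Continuous fun ε : ℝ => (p + ε) * (p + ε) + 2 * ε * a := by fun_prop
      have h0 := (this.tendsto 0).mono_left (nhdsWithin_le_nhds (s := Set.Ioi 0))
      simpa using h0
    exact ge_of_tendsto hc (eventually_mem_nhdsWithin.mono fun ε hε' => hε ε hε')
  have hcompl : ρ.real Iᶜ = a - p := by
    have := measureReal_add_measureReal_compl (μ := ρ) mI
    linarith
  have hp0 : 0 ≤ p := measureReal_nonneg
  have hc0 : 0 ≤ a - p := hcompl ▸ measureReal_nonneg
  have hz : p * (a - p) = 0 := le_antisymm (by nlinarith) (mul_nonneg hp0 hc0)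
  have hback : ∀ s, ρ.real s = 0 → ν ({x | x 0 = e} ∩ s) = 0 := by
    intro s hs
    rwa [measureReal_eq_zero_iff, hρ, Measure.restrict_apply' mA, Set.inter_comm] at hs
  rcases mul_eq_zero.1 hz with h0 | h0
  · exact .inl (hback _ h0)
  · exact .inr (hback _ (hcompl.trans h0))

/-- A stationary Markov measure charging all states is conservative and ergodic if and only if the
expected number of visits to any state, starting from any state, is infinite. -/
theorem conservative_and_ergodic_iff [Countable E] (h : IsStationaryMarkov ν)
    (hpos : ∀ e, ν {x | x 0 = e} ≠ 0) :
    Conservative (shiftBy 1) ν ∧ Ergodic (shiftBy 1) ν ↔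
      ∀ a b, ∑' n : ℕ, ν {x | x 0 = a ∧ x n = b} = ∞ := by
  constructor
  · rintro ⟨hc, herg⟩ a b
    by_contra hne
    set V : Set (ℤ → E) := {x | ∃ᶠ n : ℕ in atTop, x n = b} with hV
    have mb : ∀ j : ℤ, Measurable fun x : ℤ → E => x j = b := fun j => measurable_eval_eq j b
    have mV : MeasurableSet V := by
      simp only [hV, frequently_atTop]
      exact measurableSet_setOfPred.2 (Measurable.forall fun i => Measurable.exists fun j =>
        measurable_const.and (mb j))
    have hV1 : shiftBy 1 ⁻¹' V = V := by
      ext x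
      simp only [hV, Set.mem_preimage, Set.mem_ofPred_eq, shiftBy]
      conv_rhs => rw [← map_add_atTop_eq_nat 1, frequently_map]
      simp
    -- By conservativity almost every path starting at `b` returns there infinitely often, so a null
    -- `V` would make `{x | x 0 = b}` null.
    have hVpos : ν V ≠ 0 := by
      intro h0
      apply hpos b
      have h1 := hc.ae_mem_imp_frequently_image_mem (measurableSet_zero b).nullMeasurableSet
      rw [measure_eq_zero_iff_ae_notMem] at h0 ⊢
      filter_upwards [h0, h1] with x hx0 hx1 hx
      refine hx0 ((hx1 hx).mono fun n hn => ?_)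
      rw [shiftBy_iterate] at hn
      simpa [shiftBy] using hn
    have hfull : ∀ᵐ x ∂ν, x ∈ V := by
      rcases herg.toPreErgodic.ae_mem_or_ae_notMem mV hV1 with h1 | h1
      · exact h1
      · exact absurd (measure_eq_zero_iff_ae_notMem.2 h1) hVpos
    apply hpos a
    rw [measure_eq_zero_iff_ae_notMem]
    filter_upwards [hfull, ae_eventually_notMem hne] with x hx hx' hxa
    obtain ⟨n, h1, h2⟩ := (hx.and_eventually hx').exists
    exact h2 ⟨hxa, h1⟩
  · intro hsum
    refine ⟨h.conservative fun e => h.ae_frequently_return e (h.ae_exists_return e (hsum e e)),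
      ⟨h.measurePreserving, ⟨fun I mI hI => ?_⟩⟩⟩
    have hz := fun e => h.zero_one e (hsum e e) mI hI
    rw [eventuallyConst_set]
    by_cases hall : ∀ e, ν ({x | x 0 = e} ∩ Iᶜ) = 0
    · left
      have : ν (⋃ e, {x | x 0 = e} ∩ Iᶜ) = 0 := measure_iUnion_null hall
      filter_upwards [measure_eq_zero_iff_ae_notMem.1 this] with x hx
      by_contra hxI
      exact hx (Set.mem_iUnion.2 ⟨x 0, rfl, hxI⟩)
    · right
      push Not at hall
      obtain ⟨b, hb⟩ := hall
      have hb0 : ν ({x | x 0 = b} ∩ I) = 0 := (hz b).resolve_right hb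
      have hall : ∀ a, ν ({x | x 0 = a} ∩ I) = 0 := by
        intro a
        refine (hz a).resolve_right fun ha => ?_
        -- If `I` has full mass over `a` and none over `b`, its invariance forbids passing from `a`
        -- to `b`, contradicting divergence of the series for `(a, b)`.
        have hzero : ∀ n : ℕ, ν {x | x 0 = a ∧ x n = b} = 0 := by
          intro n
          have h1 := (h.measurePreserving_shiftBy n).quasiMeasurePreserving.preimage_null hb0
          refine measure_mono_null (t := ({x | x 0 = a} ∩ Iᶜ) ∪
            shiftBy n ⁻¹' ({x | x 0 = b} ∩ I)) ?_ (measure_union_null ha h1)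
          rintro x ⟨hxa, hxb⟩
          by_cases hxI : x ∈ I
          · exact .inr ⟨by simpa [shiftBy] using hxb, (shiftBy_mem_iff hI n x).2 hxI⟩
          · exact .inl ⟨hxa, hxI⟩
        have := hsum a b
        simp [hzero] at this
      have : ν (⋃ e, {x | x 0 = e} ∩ I) = 0 := measure_iUnion_null hall
      filter_upwards [measure_eq_zero_iff_ae_notMem.1 this] with x hx hxI
      exact hx (Set.mem_iUnion.2 ⟨x 0, rfl, hxI⟩)

end IsStationaryMarkov

/-- The preimage of a set of positive measure has positive measure, and a returning point of it
projects to a returning point. -/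
theorem conservative_of_semiconj {X Y : Type*} [MeasurableSpace X] [MeasurableSpace Y]
    {μ : Measure X} {ν : Measure Y} {f : X → X} {g : Y → Y} {φ : X → Y}
    (hφ : MeasurePreserving φ μ ν) (hsemi : Function.Semiconj φ f g) (hg : MeasurePreserving g ν ν)
    (hf : Conservative f μ) : Conservative g ν := by
  refine ⟨hg.quasiMeasurePreserving, fun s ms hs => ?_⟩
  rw [← hφ.measure_preimage ms.nullMeasurableSet] at hs
  obtain ⟨x, hx, n, hn, hxn⟩ := hf.exists_mem_iterate_mem' (hφ.measurable ms) hs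
  refine ⟨φ x, hx, n, hn, ?_⟩
  rw [← (hsemi.iterate_right n).eq]
  exact hxn

/-! ### Products of Markov shifts as shifts on paths in `S^k` -/

namespace InfiniteMarkovData

variable {S : Type*} [MeasurableSpace S]

/-- Conjugation of `mixedShift k m` with a shift: the paths of the last `k - m` coordinates are
reversed. -/
def itinerary (k m : ℕ) : (Fin k → ℤ → S) ≃ᵐ (ℤ → Fin k → S) where
  toFun x n i := x i (if (i : ℕ) < m then n else -n)
  invFun y i n := y (if (i : ℕ) < m then n else -n) i
  left_inv x := by
    funext i n
    dsimp only
    split_ifs <;> simp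
  right_inv y := by
    funext n i
    dsimp only
    split_ifs <;> simp
  measurable_toFun := by
    refine measurable_pi_lambda _ fun n => measurable_pi_lambda _ fun i => ?_
    change Measurable fun x : Fin k → ℤ → S => x i (if (i : ℕ) < m then n else -n)
    fun_prop
  measurable_invFun := by
    refine measurable_pi_lambda _ fun i => measurable_pi_lambda _ fun n => ?_
    change Measurable fun y : ℤ → Fin k → S => y (if (i : ℕ) < m then n else -n) i
    fun_prop

theorem itinerary_apply (k m : ℕ) (x : Fin k → ℤ → S) (n : ℤ) (i : Fin k) :
    itinerary k m x n i = x i (if (i : ℕ) < m then n else -n) := rfl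

theorem itinerary_semiconj (k m : ℕ) :
    Function.Semiconj (itinerary (S := S) k m) (mixedShift k m) (shiftBy 1) := by
  intro x
  funext n i
  simp only [shiftBy, itinerary_apply, mixedShift]
  split_ifs
  · rfl
  · change x i (-n - 1) = x i (-(n + 1))
    congr 1; ring

variable [DiscreteMeasurableSpace S] (M : InfiniteMarkovData S)

theorem ae_chainLaw_zero (p : S → PMF S) (s : S) : ∀ᵐ x ∂(chainLaw p s), x 0 = s := by
  have := chainLaw_cylinder p s (fun _ => s) 0
  simp only [Nat.le_zero, forall_eq, if_true, Finset.range_zero, Finset.prod_empty] at this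
  exact (prob_compl_eq_zero_iff (measurableSet_eval_eq 0 s)).2 this

/-- Under the Markov measure restricted to paths in the state `s` at time `0`, the future and the
past are independent chains. -/
theorem markovMeasure_restrict_map (s : S) :
    (M.markovMeasure.restrict {x | x 0 = s}).map
        (fun x => ((fun n : ℕ => x n), (fun n : ℕ => x (-n)))) =
      ((M.lam s : ℝ≥0∞) • chainLaw M.forward s).prod (chainLaw M.backward s) := by
  have hm : Measurable fun x : ℤ → S => ((fun n : ℕ => x n), (fun n : ℕ => x (-n))) := by fun_prop
  ext B hB
  have mA : MeasurableSet {x : ℤ → S | x 0 = s} := measurableSet_eval_eq 0 s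
  rw [Measure.map_apply hm hB, Measure.restrict_apply (hm hB), markovMeasure,
    Measure.sum_apply _ ((hm hB).inter mA)]
  have hterm : ∀ t, ((chainLaw M.forward t).prod (chainLaw M.backward t)).map glue
      ((fun x : ℤ → S => ((fun n : ℕ => x n), (fun n : ℕ => x (-n)))) ⁻¹' B ∩ {x | x 0 = s}) =
      ((chainLaw M.forward t).prod (chainLaw M.backward t)) {z | t = s ∧ z ∈ B} := by
    intro t
    rw [Measure.map_apply measurable_glue ((hm hB).inter mA)]
    refine measure_congr ?_
    -- `glue` takes the time-`0` state from the future and discards that of the past; `z` is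
    -- recovered from `glue z` because both are almost surely `t`.
    have h1 := Measure.quasiMeasurePreserving_fst (μ := chainLaw M.forward t)
      (ν := chainLaw M.backward t) |>.ae (ae_chainLaw_zero M.forward t)
    have h2 := Measure.quasiMeasurePreserving_snd (μ := chainLaw M.forward t)
      (ν := chainLaw M.backward t) |>.ae (ae_chainLaw_zero M.backward t)
    filter_upwards [h1, h2] with z h1 h2
    have e1 : (fun n : ℕ => glue z n) = z.1 := by funext n; simp [glue]
    have e2 : (fun n : ℕ => glue z (-n)) = z.2 := by
      funext n
      rcases Nat.eq_zero_or_pos n with rfl | hn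
      · simp [glue, h1, h2]
      · simp only [glue]
        rw [if_neg (by omega)]
        simp
    have e3 : glue z 0 = t := by simpa [glue] using h1
    refine propext ?_
    change ((fun n : ℕ => glue z n, fun n : ℕ => glue z (-n)) ∈ B ∧ glue z 0 = s) ↔ t = s ∧ z ∈ B
    rw [e1, e2, e3, and_comm]
  simp only [Measure.smul_apply, hterm]
  rw [tsum_eq_single s (by intro t ht; simp [ht])]
  simp [Measure.prod_smul_left]

theorem markovMeasure_zero (s : S) : M.markovMeasure {x | x 0 = s} = M.lam s := by
  have h := congrArg (fun ρ => ρ Set.univ) (M.markovMeasure_restrict_map s)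
  rw [Measure.map_apply (by fun_prop) .univ] at h
  rw [Set.preimage_univ, Measure.restrict_apply_univ] at h
  rw [h, ← Set.univ_prod_univ, Measure.prod_prod]
  simp

/-- The joint law, under the Markov measure restricted to paths in the state `s` at time `0`, of the
future and the past, possibly exchanged. -/
theorem exists_prod_law (s : S) (c : Prop) [Decidable c] :
    ∃ α β : Measure (ℕ → S), IsFiniteMeasure α ∧ IsFiniteMeasure β ∧
      (M.markovMeasure.restrict {x | x 0 = s}).map (fun x =>
        ((fun n : ℕ => x (if c then (n : ℤ) else -n)),
          (fun n : ℕ => x (if c then -(n : ℤ) else - -n)))) = α.prod β := by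
  have hfin : IsFiniteMeasure ((M.lam s : ℝ≥0∞) • chainLaw M.forward s) :=
    Measure.smul_finite _ ENNReal.coe_ne_top
  by_cases hc : c
  · refine ⟨_, chainLaw M.backward s, hfin, inferInstance, ?_⟩
    simp only [hc, if_true]
    exact M.markovMeasure_restrict_map s
  · refine ⟨chainLaw M.backward s, _, inferInstance, hfin, ?_⟩
    rw [← Measure.prod_swap, ← M.markovMeasure_restrict_map s,
      Measure.map_map measurable_swap (by fun_prop)]
    simp only [hc, if_false, neg_neg]
    rfl

variable [Countable S]

/-- The shift preserves the Markov measure. -/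
theorem measurePreserving_shift :
    MeasurePreserving shift M.markovMeasure M.markovMeasure := by
  refine ⟨shift.measurable, ?_⟩
  set 𝒞 : Set (Set (ℤ → S)) := {s | ∃ (N : ℕ) (v : ℤ → S), s = {x | ∀ j : ℤ, j.natAbs ≤ N → x j = v j}}
    with h𝒞
  have hwin : ∀ (N : ℕ) (v : ℤ → S), {x : ℤ → S | ∀ j : ℤ, j.natAbs ≤ N → x j = v j} =
      {x | ∀ i : ℕ, i ≤ 2 * N → x (-N + i) = v (-N + i)} := by
    intro N v
    ext x
    refine ⟨fun h i hi => h _ (by omega), fun h j hj => ?_⟩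
    have := h (j + N).toNat (by omega)
    rwa [show -(N : ℤ) + (j + N).toNat = j by omega] at this
  have hmeas : ∀ s ∈ 𝒞, MeasurableSet s := by
    rintro _ ⟨N, v, rfl⟩
    rw [hwin]
    exact measurableSet_window _ _ _
  have hpi : IsPiSystem 𝒞 := by
    -- Windows centred at `0` are nested, so two cylinders that meet intersect in the one with the
    -- longer window.
    have hle : ∀ (N N' : ℕ) (v v' : ℤ → S), N ≤ N' →
        ({x : ℤ → S | ∀ j : ℤ, j.natAbs ≤ N → x j = v j} ∩
          {x | ∀ j : ℤ, j.natAbs ≤ N' → x j = v' j}).Nonempty →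
        {x : ℤ → S | ∀ j : ℤ, j.natAbs ≤ N → x j = v j} ∩
          {x | ∀ j : ℤ, j.natAbs ≤ N' → x j = v' j} =
          {x | ∀ j : ℤ, j.natAbs ≤ N' → x j = v' j} := by
      rintro N N' v v' hN ⟨y, hy, hy'⟩
      refine Set.inter_eq_right.2 fun x hx j hj => ?_
      rw [hx j (hj.trans hN), ← hy j hj, hy' j (hj.trans hN)]
    rintro _ ⟨N, v, rfl⟩ _ ⟨N', v', rfl⟩ hne
    rcases le_total N N' with h | h
    · exact ⟨N', v', hle N N' v v' h hne⟩
    · rw [Set.inter_comm] at hne ⊢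
      exact ⟨N, v, hle N' N v' v h hne⟩
  have hgen : (MeasurableSpace.pi : MeasurableSpace (ℤ → S)) = MeasurableSpace.generateFrom 𝒞 := by
    refine le_antisymm (iSup_le fun i => ?_) (MeasurableSpace.generateFrom_le hmeas)
    rintro _ ⟨s, -, rfl⟩
    -- A condition at time `i` is a union over words on a centred window containing `i`; the union
    -- is countable as the window is finite and `S` countable.
    have hU : (fun x : ℤ → S => x i) ⁻¹' s = ⋃ u : {u : Finset.Icc (-(i.natAbs : ℤ)) i.natAbs → S //
        u ⟨i, Finset.mem_Icc.2 (by omega)⟩ ∈ s}, {x | ∀ j : Finset.Icc (-(i.natAbs : ℤ)) i.natAbs, x j = u.1 j} := by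
      ext x
      simp only [Set.mem_preimage, Set.mem_iUnion, Set.mem_ofPred_eq]
      constructor
      · intro hx
        exact ⟨⟨fun j => x j, hx⟩, fun j => rfl⟩
      · rintro ⟨⟨u, hu⟩, hux⟩
        have hi : x i = u ⟨i, Finset.mem_Icc.2 (by omega)⟩ := hux ⟨i, _⟩
        rwa [← hi] at hu
    rw [hU]
    refine @MeasurableSet.iUnion _ _ (MeasurableSpace.generateFrom 𝒞) _ _ fun u => ?_
    rcases Set.eq_empty_or_nonempty {x : ℤ → S |
        ∀ j : Finset.Icc (-(i.natAbs : ℤ)) i.natAbs, x j = u.1 j} with h0 | ⟨y, hy⟩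
    · rw [h0]; exact @MeasurableSet.empty _ (MeasurableSpace.generateFrom 𝒞)
    · refine MeasurableSpace.measurableSet_generateFrom ⟨i.natAbs, y, ?_⟩
      ext x
      constructor
      · intro hx j hj
        have hj' : j ∈ Finset.Icc (-(i.natAbs : ℤ)) i.natAbs := Finset.mem_Icc.2 (by omega)
        rw [hx ⟨j, hj'⟩, hy ⟨j, hj'⟩]
      · intro hx j
        have := Finset.mem_Icc.1 j.2
        rw [hx j (by omega), hy j]
  have hmass : ∀ s : S, M.markovMeasure.map shift {x | x 0 = s} = M.lam s := by
    intro s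
    rw [Measure.map_apply shift.measurable (measurableSet_eval_eq 0 s)]
    have h := M.markovMeasure_cylinder 1 0 (fun _ => s)
    simpa using! h
  refine Measure.ext_of_generateFrom_of_cover_subset (S := 𝒞)
    (T := Set.range fun s : S => {x : ℤ → S | x 0 = s}) hgen hpi ?_ (Set.countable_range _) ?_ ?_ ?_
  · rintro _ ⟨s, rfl⟩
    refine ⟨0, fun _ => s, ?_⟩
    ext x
    simp
  · ext x; simp
  · rintro _ ⟨s, rfl⟩
    rw [hmass]
    exact ENNReal.coe_ne_top
  · rintro _ ⟨N, v, rfl⟩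
    rw [hwin, Measure.map_apply shift.measurable (measurableSet_window _ _ _)]
    have h1 := M.window (fun j => v (j - 1)) (-N + 1) (2 * N)
    have h2 := M.window v (-N) (2 * N)
    rw [h2]
    have e : ∀ i : ℕ, -(N : ℤ) + 1 + i - 1 = -N + i := fun i => by ring
    have e' : ∀ i : ℕ, -(N : ℤ) + 1 + i + 1 - 1 = -N + i + 1 := fun i => by ring
    simp only [e, e', add_sub_cancel_right] at h1
    rw [← h1]
    congr 1
    ext x
    refine forall_congr' fun i => imp_congr_right fun _ => ?_
    change x (-N + i + 1) = _ ↔ _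
    rw [show -(N : ℤ) + 1 + i = -N + i + 1 by ring]

theorem measurePreserving_mixedShift (k m : ℕ) :
    MeasurePreserving (mixedShift k m) (M.powerMeasure k) (M.powerMeasure k) := by
  have h : ∀ i : Fin k, MeasurePreserving
      (fun x : ℤ → S => if (i : ℕ) < m then shift x else shift.symm x)
      M.markovMeasure M.markovMeasure := by
    intro i
    split_ifs
    · exact M.measurePreserving_shift
    · exact MeasurePreserving.symm shift M.measurePreserving_shift
  exact measurePreserving_pi _ _ h

theorem powerMeasure_pi (k : ℕ) (B : Fin k → Set (ℤ → S)) :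
    M.powerMeasure k {x | ∀ i, x i ∈ B i} = ∏ i, M.markovMeasure (B i) := by
  rw [powerMeasure, ← Measure.pi_pi]
  congr 1
  ext x
  simp

/-- Given the present, each coordinate has a product law for its future and past; regrouping the `k`
pairs gives one product law. The unsimplified `- -n` is what `itinerary` produces at time `-n`. -/
theorem exists_power_prod_law (k m : ℕ) (e : Fin k → S) :
    ∃ α β : Measure (Fin k → ℕ → S), ∀ F G, MeasurableSet F → MeasurableSet G →
      M.powerMeasure k {x | (∀ i, x i 0 = e i) ∧
        (fun (i : Fin k) (n : ℕ) => x i (if (i : ℕ) < m then (n : ℤ) else -n)) ∈ F ∧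
        (fun (i : Fin k) (n : ℕ) => x i (if (i : ℕ) < m then -(n : ℤ) else - -n)) ∈ G} =
      α F * β G := by
  choose α β hα hβ h using fun i : Fin k => M.exists_prod_law (e i) ((i : ℕ) < m)
  refine ⟨Measure.pi α, Measure.pi β, fun F G hF hG => ?_⟩
  set f : Fin k → (ℤ → S) → (ℕ → S) × (ℕ → S) := fun i x =>
    ((fun n : ℕ => x (if (i : ℕ) < m then (n : ℤ) else -n)),
      (fun n : ℕ => x (if (i : ℕ) < m then -(n : ℤ) else - -n))) with hf
  have mf : ∀ i, Measurable (f i) := fun i => by fun_prop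
  have hmap : (Measure.pi fun i => M.markovMeasure.restrict {x | x 0 = e i}).map
      (fun x i => f i (x i)) = Measure.pi fun i => (α i).prod (β i) := by
    have : ∀ i, SigmaFinite ((M.markovMeasure.restrict {x | x 0 = e i}).map (f i)) := fun i => by
      rw [hf, h i]; infer_instance
    rw [Measure.pi_map_pi fun i => (mf i).aemeasurable]
    congr 1
    funext i
    exact h i
  have hprod := (measurePreserving_arrowProdEquivProdArrow (ℕ → S) (ℕ → S) (Fin k) α β).measure_preimage
    (hF.prod hG).nullMeasurableSet
  have mpre : MeasurableSet ((MeasurableEquiv.arrowProdEquivProdArrow (ℕ → S) (ℕ → S) (Fin k)) ⁻¹'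
      F ×ˢ G) := (MeasurableEquiv.measurable _) (hF.prod hG)
  have mfx : Measurable fun (x : Fin k → ℤ → S) i => f i (x i) := by fun_prop
  rw [Measure.prod_prod, ← hmap, Measure.map_apply mfx mpre, ← Measure.restrict_pi_pi,
    Measure.restrict_apply (mfx mpre)] at hprod
  rw [← hprod, powerMeasure]
  congr 1
  ext x
  simp only [Set.mem_inter_iff, Set.mem_preimage, Set.mem_pi, Set.mem_univ, true_imp_iff,
    Set.mem_ofPred_eq]
  exact and_comm

/-- The itineraries of a product of Markov shifts and of their inverses form a stationary Markov
chain. -/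
theorem isStationaryMarkov_itinerary (k m : ℕ) :
    IsStationaryMarkov ((M.powerMeasure k).map (itinerary k m)) := by
  have hI := (itinerary (S := S) k m).measurable
  have hzero : ∀ (e : Fin k → S) (x : Fin k → ℤ → S),
      itinerary k m x 0 = e ↔ ∀ i, x i 0 = e i := fun e x => by
    simp [funext_iff, itinerary_apply]
  refine ⟨⟨measurable_shiftBy 1, ?_⟩, fun e => ?_, fun e F G hF hG => ?_⟩
  · rw [Measure.map_map (measurable_shiftBy 1) hI, ← (itinerary_semiconj k m).comp_eq,
      ← Measure.map_map hI (M.measurePreserving_mixedShift k m).measurable,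
      (M.measurePreserving_mixedShift k m).map_eq]
  · rw [Measure.map_apply hI (IsStationaryMarkov.measurableSet_zero e)]
    have := M.powerMeasure_pi k fun i => {x | x 0 = e i}
    simp only [markovMeasure_zero, Set.mem_ofPred_eq] at this
    simp only [Set.preimage_ofPred_eq, hzero, this]
    exact ENNReal.prod_ne_top fun i _ => ENNReal.coe_ne_top
  · obtain ⟨α, β, h⟩ := M.exists_power_prod_law k m e
    have msw : Measurable fun (w : Fin k → ℕ → S) (n : ℕ) (i : Fin k) => w i n := by fun_prop
    have key : ∀ F G : Set (ℕ → Fin k → S), MeasurableSet F → MeasurableSet G →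
        (M.powerMeasure k).map (itinerary k m) {x | x 0 = e ∧ (fun n : ℕ => x n) ∈ F ∧
          (fun n : ℕ => x (-n)) ∈ G} =
          α ((fun w n i => w i n) ⁻¹' F) * β ((fun w n i => w i n) ⁻¹' G) := by
      intro F G hF hG
      have hf : Measurable fun (x : ℤ → Fin k → S) (n : ℕ) => x n := by fun_prop
      have hg : Measurable fun (x : ℤ → Fin k → S) (n : ℕ) => x (-n) := by fun_prop
      rw [Measure.map_apply hI, ← h _ _ (msw hF) (msw hG)]
      · congr 1
        ext x
        simp only [Set.mem_preimage, Set.mem_ofPred_eq, hzero]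
        rfl
      · exact (IsStationaryMarkov.measurableSet_zero e).inter ((hf hF).inter (hg hG))
    -- With every mass of the form `α F * β G`, conditional independence is a rearrangement of four
    -- factors.
    have h1 := key F G hF hG
    have h2 := key F .univ hF .univ
    have h3 := key .univ G .univ hG
    have h4 := key .univ .univ .univ .univ
    simp only [Set.mem_univ, and_true, true_and, Set.preimage_univ] at h1 h2 h3 h4
    rw [h1, h2, h3, h4]
    ring

/-- A reversed coordinate is observed at times `0` and `-n`; translating by `n` exchanges its
initial and final states. -/
theorem map_itinerary_apply (k m : ℕ) (a b : Fin k → S) (n : ℕ) :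
    (M.powerMeasure k).map (itinerary k m) {x | x 0 = a ∧ x n = b} =
      ∏ i : Fin k, if (i : ℕ) < m then M.markovMeasure {x | x 0 = a i ∧ x n = b i}
        else M.markovMeasure {x | x 0 = b i ∧ x n = a i} := by
  have m1 : MeasurableSet {x : ℤ → Fin k → S | x 0 = a ∧ x n = b} :=
    (measurableSet_eval_eq _ _).inter (measurableSet_eval_eq _ _)
  rw [Measure.map_apply (itinerary k m).measurable m1]
  have h := M.powerMeasure_pi k fun i =>
    {x | x 0 = a i ∧ x (if (i : ℕ) < m then (n : ℤ) else -n) = b i}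
  have hinv : ∀ s t : S, M.markovMeasure {x | x 0 = s ∧ x (-n) = t} =
      M.markovMeasure {x | x 0 = t ∧ x n = s} := by
    intro s t
    have mp := M.measurePreserving_shift.iterate n
    have hs : (shift : (ℤ → S) → ℤ → S)^[n] = shiftBy n := shiftBy_iterate n
    rw [hs] at mp
    have m2 : MeasurableSet {x : ℤ → S | x 0 = s ∧ x (-n) = t} :=
      (measurableSet_eval_eq _ _).inter (measurableSet_eval_eq _ _)
    rw [← mp.measure_preimage m2.nullMeasurableSet]
    congr 1
    ext x
    simp [shiftBy, and_comm]
  convert h using 1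
  · congr 1
    ext x
    simp [funext_iff, itinerary_apply, forall_and]
  · refine Finset.prod_congr rfl fun i _ => ?_
    split_ifs
    · rfl
    · exact (hinv _ _).symm

/-- The criterion for stationary Markov measures, carried back through the conjugacy `itinerary`;
its positivity assumption comes from `lam_pos`. -/
theorem mixedShift_conservative_and_ergodic_iff (k m : ℕ) :
    Conservative (mixedShift k m) (M.powerMeasure k) ∧ Ergodic (mixedShift k m) (M.powerMeasure k) ↔
      ∀ a b : Fin k → S, ∑' n : ℕ, ∏ i : Fin k,
        (if (i : ℕ) < m then M.markovMeasure {x | x 0 = a i ∧ x n = b i}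
          else M.markovMeasure {x | x 0 = b i ∧ x n = a i}) = ∞ := by
  have hν := M.isStationaryMarkov_itinerary k m
  have mp : MeasurePreserving (itinerary k m) (M.powerMeasure k)
      ((M.powerMeasure k).map (itinerary k m)) := ⟨(itinerary k m).measurable, rfl⟩
  have hsemi := itinerary_semiconj (S := S) k m
  have hsemi' : Function.Semiconj (itinerary (S := S) k m).symm (shiftBy 1) (mixedShift k m) :=
    fun y => by
      rw [MeasurableEquiv.symm_apply_eq, hsemi.eq, MeasurableEquiv.apply_symm_apply]
  have hpos : ∀ e : Fin k → S, (M.powerMeasure k).map (itinerary k m) {x | x 0 = e} ≠ 0 := by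
    intro e
    have h := M.map_itinerary_apply k m e e 0
    simp only [Nat.cast_zero, and_self, ite_self, markovMeasure_zero] at h
    rw [h]
    exact Finset.prod_ne_zero_iff.2 fun i _ => ENNReal.coe_ne_zero.2 (M.lam_pos _).ne'
  simp only [← map_itinerary_apply]
  rw [← hν.conservative_and_ergodic_iff hpos]
  have hmix := M.measurePreserving_mixedShift k m
  have mp' := MeasurePreserving.symm _ mp
  constructor
  · rintro ⟨hc, he⟩
    exact ⟨conservative_of_semiconj mp hsemi hν.measurePreserving hc,
      hν.measurePreserving, mp.preErgodic_of_preErgodic_semiconj he.toPreErgodic hsemi⟩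
  · rintro ⟨hc, he⟩
    exact ⟨conservative_of_semiconj mp' hsemi' hmix hc,
      hmix, mp'.preErgodic_of_preErgodic_semiconj he.toPreErgodic hsemi'⟩

end InfiniteMarkovData

/-! ### Comparison of the two divergence criteria -/

theorem corollary3p2 {S : Type*} [Countable S] [MeasurableSpace S] [DiscreteMeasurableSpace S]
    (M : InfiniteMarkovData S) (m k : ℕ) (hm : m ≤ k) :
    (Conservative (InfiniteMarkovData.mixedShift k m) (M.powerMeasure k) ∧
        Ergodic (InfiniteMarkovData.mixedShift k m) (M.powerMeasure k)) ↔
      (Conservative (InfiniteMarkovData.powerShift k) (M.powerMeasure k) ∧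
        Ergodic (InfiniteMarkovData.powerShift k) (M.powerMeasure k)) := by
  have hk : (InfiniteMarkovData.powerShift k : (Fin k → ℤ → S) → Fin k → ℤ → S) =
      InfiniteMarkovData.mixedShift k k := by
    funext x i
    simp [InfiniteMarkovData.powerShift, InfiniteMarkovData.mixedShift]
  rw [hk, M.mixedShift_conservative_and_ergodic_iff, M.mixedShift_conservative_and_ergodic_iff]
  simp only [Fin.is_lt, if_true]
  constructor
  all_goals
    intro h a b
    -- Exchanging the two states in the coordinates `i ≥ m` is an involution on pairs, so one
    -- substitution serves both implications.
    rw [← h (fun i => if (i : ℕ) < m then a i else b i) (fun i => if (i : ℕ) < m then b i else a i)]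
    congr with n
    refine Finset.prod_congr rfl fun i _ => ?_
    split_ifs <;> rfl
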